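/- Let $\Gamma\subset\mathbb C$ be a rectifiable Jordan curve (a curve of finite length homeomorphic to a circle), oriented and equipped with its length measure $|d\tau|$; for $t\in\Gamma$ and $R>0$ put $\Gamma(t,R)=\{\tau\in\Gamma:|\tau-t|<R\}$. Let $\rho$ be a Banach function norm on the set $\mathcal M^+$ of measurable functions $\Gamma\to[0,\infty]$, that is, a map $\rho:\mathcal M^+\to[0,\infty]$ such that for all $f,g,f_n\in\mathcal M^+$, all constants $a\ge 0$ and all measurable $E\subset\Gamma$: (A1) $\rho(f)=0\Leftrightarrow f=0$ a.e., $\rho(af)=a\rho(f)$, $\rho(f+g)\le\rho(f)+\rho(g)$; (A2) $0\le g\le f$ a.e. implies $\rho(g)\le\rho(f)$; (A3) $0\le f_n\uparrow f$ a.e. implies $\rho(f_n)\uparrow\rho(f)$; (A4) $\rho(\chi_E)<\infty$; (A5) $\int_E f\,|d\tau|\le C_E\,\rho(f)$ with some $C_E\in(0,\infty)$ independent of $f$. Let $X$ be the Banach function space of all measurable $f:\Gamma\to\mathbb C$ with $\|f\|_X:=\rho(|f|)<\infty$, and let $X'$ be its associate space, generated by $\rho'(g)=\sup\{\int_\Gamma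 fg\,|d\tau| : f\in\mathcal M^+,\ \rho(f)\le 1\}$. Let $w$ be a weight, i.e. a measurable function $w:\Gamma\to[0,\infty]$ with $0<w<\infty$ a.e., and let $X_w=\{f \text{ measurable}: fw\in X\}$ with $\|f\|_{X_w}=\|fw\|_X$. Suppose that the Cauchy singular integral operator $$(Sf)(t)=\lim_{R\to 0+}\frac1{\pi i}\int_{\Gamma\setminus\Gamma(t,R)}\frac{f(\tau)}{\tau-t}\,d\tau$$ is bounded on $X_w$, in the sense that there is a constant $C<\infty$ such that for every integrable $f\in X_w$ the limit $(Sf)(t)$ exists for a.e. $t\in\Gamma$, $Sf\in X_w$, and $\|Sf\|_{X_w}\le C\|f\|_{X_w}$. (This holds in particular if $S$ is defined on all of $X_w$ and is a bounded operator $X_w\to X_w$.) Then $w$ belongs to the Muckenhoupt-type class $A_X(\Gamma)$, that is, $$\sup_{t\in\Gamma}\ \sup_{R>0}\ \frac1R\,\big\|w\,\chi_{\Gamma(t,R)}\big\|_X\,\big\|\chi_{\Gamma(t,R)}/w\big\|_{X'}<\infty .$$ -/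

import Mathlib

open Set Filter Topology MeasureTheory
open scoped ENNReal NNReal

noncomputable section

/-- A rectifiable Jordan curve in the plane, given by a parametrization over `[0, 1]` that is
continuous, closed, otherwise injective, and of bounded variation (finite length).
The curve is oriented by the parametrization; either orientation is allowed. -/
structure RectifiableJordanCurve where
  toFun : ℝ → ℂ
  continuousOn : ContinuousOn toFun (Icc 0 1)
  closed : toFun 0 = toFun 1
  injOn : InjOn toFun (Ico 0 1)
  boundedVariationOn : BoundedVariationOn toFun (Icc 0 1)

namespace RectifiableJordanCurve

/-- The underlying point set `Γ ⊆ ℂ`. -/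
def carrier (Γ : RectifiableJordanCurve) : Set ℂ := Γ.toFun '' Icc 0 1

/-- The length `|Γ|`. -/
def length (Γ : RectifiableJordanCurve) : ℝ := (eVariationOn Γ.toFun (Icc 0 1)).toReal

/-- The arc-length parametrization of `Γ`, a unit speed map on `[0, |Γ|]`. -/
def arcParam (Γ : RectifiableJordanCurve) : ℝ → ℂ :=
  naturalParameterization Γ.toFun (Icc 0 1) 0

/-- The Lebesgue length measure `|dτ|` of `Γ`, as a measure on `ℂ` concentrated on `Γ`:
the image of Lebesgue measure on `[0, |Γ|]` under the arc-length parametrization.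
Functions on `Γ` are represented by functions on `ℂ`; their values off `Γ` play no role. -/
def lengthMeasure (Γ : RectifiableJordanCurve) : Measure ℂ :=
  (volume.restrict (Icc 0 Γ.length)).map Γ.arcParam

/-- The contour integral `∫_Γ F(τ) dτ`, with `dτ = σ'(s) ds` for the arc-length
parametrization `τ = σ(s)` (a Lipschitz map, differentiable almost everywhere). -/
def contourIntegral (Γ : RectifiableJordanCurve) (F : ℂ → ℂ) : ℂ :=
  ∫ s in (0 : ℝ)..Γ.length, F (Γ.arcParam s) * deriv Γ.arcParam s

/-- The portion `Γ(t, R) = {τ ∈ Γ : |τ - t| < R}`. -/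
def portion (Γ : RectifiableJordanCurve) (t : ℂ) (R : ℝ) : Set ℂ :=
  {τ | τ ∈ Γ.carrier ∧ ‖τ - t‖ < R}

/-- The truncated integral `(1 / (π i)) ∫_{Γ \ Γ(t, R)} f(τ) / (τ - t) dτ`. -/
def truncatedCauchy (Γ : RectifiableJordanCurve) (f : ℂ → ℂ) (t : ℂ) (R : ℝ) : ℂ :=
  1 / (Real.pi * Complex.I) *
    Γ.contourIntegral ((Γ.carrier \ Γ.portion t R).indicator fun τ => f τ / (τ - t))

/-- `g` is the Cauchy singular integral `S f`: for almost every `t ∈ Γ` the truncated integrals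
converge, as `R → 0+`, to `g t`. -/
def IsCauchySingularIntegral (Γ : RectifiableJordanCurve) (f g : ℂ → ℂ) : Prop :=
  ∀ᵐ t ∂Γ.lengthMeasure, Tendsto (fun R => Γ.truncatedCauchy f t R) (𝓝[>] 0) (𝓝 (g t))

end RectifiableJordanCurve

/-- Luxemburg's axioms (A1)-(A5) for a Banach function norm `ρ` on the nonnegative extended
real-valued measurable functions (measurable with respect to the completion of `μ`) over a
finite measure space. -/
structure IsBanachFunctionNorm {α : Type*} [MeasurableSpace α] (μ : Measure α)
    (ρ : (α → ℝ≥0∞) → ℝ≥0∞) : Prop where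
  eq_zero_iff : ∀ f, AEMeasurable f μ → (ρ f = 0 ↔ f =ᵐ[μ] 0)
  smul : ∀ (a : ℝ≥0) (f), AEMeasurable f μ → ρ (fun x => a * f x) = a * ρ f
  add_le : ∀ f g, AEMeasurable f μ → AEMeasurable g μ → ρ (f + g) ≤ ρ f + ρ g
  mono : ∀ f g, AEMeasurable f μ → AEMeasurable g μ → g ≤ᵐ[μ] f → ρ g ≤ ρ f
  fatou : ∀ (f : ℕ → α → ℝ≥0∞) (F : α → ℝ≥0∞), (∀ n, AEMeasurable (f n) μ) →
    AEMeasurable F μ →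
    (∀ᵐ x ∂μ, Monotone (fun n => f n x) ∧ Tendsto (fun n => f n x) atTop (𝓝 (F x))) →
    Monotone (fun n => ρ (f n)) ∧ Tendsto (fun n => ρ (f n)) atTop (𝓝 (ρ F))
  indicator_lt_top : ∀ E, NullMeasurableSet E μ → ρ (E.indicator 1) < ∞
  lintegral_le : ∀ E, NullMeasurableSet E μ →
    ∃ C : ℝ≥0, 0 < C ∧ ∀ f, AEMeasurable f μ → ∫⁻ x in E, f x ∂μ ≤ C * ρ f

/-- The associate norm `ρ'(g) = sup {∫ f g dμ : f ≥ 0 measurable, ρ(f) ≤ 1}`. -/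
def associateNorm {α : Type*} [MeasurableSpace α] (μ : Measure α)
    (ρ : (α → ℝ≥0∞) → ℝ≥0∞) (g : α → ℝ≥0∞) : ℝ≥0∞ :=
  ⨆ (f : α → ℝ≥0∞) (_ : AEMeasurable f μ ∧ ρ f ≤ 1), ∫⁻ x, f x * g x ∂μ

/-- A weight: a measurable function with values in `[0, ∞]`, positive and finite a.e. -/
def IsWeight {α : Type*} [MeasurableSpace α] (μ : Measure α) (w : α → ℝ≥0∞) : Prop :=
  AEMeasurable w μ ∧ ∀ᵐ x ∂μ, 0 < w x ∧ w x < ∞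

/-- The norm `ρ(|f| w)` of the weighted Banach function space `X_w` (infinite off `X_w`). -/
def weightedNorm {α : Type*} (ρ : (α → ℝ≥0∞) → ℝ≥0∞) (w : α → ℝ≥0∞) (f : α → ℂ) : ℝ≥0∞ :=
  ρ fun x => ‖f x‖ₑ * w x

/-- Membership in `X_w`: `f` is measurable and `f w ∈ X`. -/
def MemWeighted {α : Type*} [MeasurableSpace α] (μ : Measure α)
    (ρ : (α → ℝ≥0∞) → ℝ≥0∞) (w : α → ℝ≥0∞) (f : α → ℂ) : Prop :=
  AEStronglyMeasurable f μ ∧ weightedNorm ρ w f < ∞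

namespace RectifiableJordanCurve

/-- The Cauchy singular integral operator `S` is bounded on `X_w`: it maps the functions of `X_w`
on which it is a priori defined, the integrable ones, into `X_w`, with a norm bound.
(An everywhere defined bounded operator `S : X_w → X_w` is bounded in this sense.) -/
def CauchyBoundedOn (Γ : RectifiableJordanCurve) (ρ : (ℂ → ℝ≥0∞) → ℝ≥0∞) (w : ℂ → ℝ≥0∞) :
    Prop :=
  ∃ C : ℝ≥0, ∀ f : ℂ → ℂ, MemWeighted Γ.lengthMeasure ρ w f → Integrable f Γ.lengthMeasure →
    ∃ g : ℂ → ℂ, Γ.IsCauchySingularIntegral f g ∧ MemWeighted Γ.lengthMeasure ρ w g ∧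
      weightedNorm ρ w g ≤ C * weightedNorm ρ w f

/-- `B_{t,R}(w) = (1 / R) ‖w χ_{Γ(t,R)}‖_X ‖χ_{Γ(t,R)} / w‖_{X'}`. -/
def muckenhouptQuantity (Γ : RectifiableJordanCurve) (ρ : (ℂ → ℝ≥0∞) → ℝ≥0∞) (w : ℂ → ℝ≥0∞)
    (t : ℂ) (R : ℝ) : ℝ≥0∞ :=
  (ENNReal.ofReal R)⁻¹ * ρ ((Γ.portion t R).indicator w) *
    associateNorm Γ.lengthMeasure ρ ((Γ.portion t R).indicator fun τ => (w τ)⁻¹)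

/-- The class `A_X(Γ)`: the weights with `sup_{t ∈ Γ} sup_{R > 0} B_{t,R}(w) < ∞`. -/
def muckenhouptClass (Γ : RectifiableJordanCurve) (ρ : (ℂ → ℝ≥0∞) → ℝ≥0∞) :
    Set (ℂ → ℝ≥0∞) :=
  {w | IsWeight Γ.lengthMeasure w ∧
    (⨆ t ∈ Γ.carrier, ⨆ (R : ℝ) (_ : 0 < R), Γ.muckenhouptQuantity ρ w t R) < ∞}

end RectifiableJordanCurve

end

/-!
The proof compares a portion `A = Γ(t, R)` of the curve with a surrounding annular portion
`B = {τ ∈ Γ : 3R ≤ |τ - t| < 4R}`, for `R` so small that `Γ` leaves the disc of radius `4R` about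
each of its points.

Arc length is a unit speed parameter, so `τ'(s)` has modulus one almost everywhere, and
multiplying a density by its conjugate turns the complex element `dτ` into `|dτ|`
(`RectifiableJordanCurve.exists_conj_tangent`). For `τ ∈ A` and `z ∈ B` the argument of `τ - z` is
nearly that of `t - z`, so the Cauchy kernel has, up to a unimodular factor depending on the
variable in `B` only, a real part of size at least `1 / (8R)`
(`RectifiableJordanCurve.inv_le_re_phase_div`). As `A` and `B` are separated, no principal value
occurs. Testing the norm bound of `S` on suitably rotated nonnegative densities on `A`, and on
densities on `B`, therefore gives (`RectifiableJordanCurve.rho_indicator_mul_associateNorm_le`)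
`‖w χ_B‖ ‖χ_A / w‖' ≤ 8πCR` and `‖w χ_A‖ ‖χ_B / w‖' ≤ 8πCR`.
Since `Γ` crosses the annulus, `B` has length at least `R`, so that Hölder's inequality
gives `R ≤ ‖w χ_B‖ ‖χ_B / w‖'`. Multiplying the two estimates and dividing by this one yields
`‖w χ_A‖ ‖χ_A / w‖' ≤ (8πC)² R`
(`RectifiableJordanCurve.rho_portion_mul_associateNorm_portion_le`).

In particular both factors are finite on small portions, hence on `Γ` by compactness, and this
settles the radii that are bounded away from zero.
-/

/-! ### Lipschitz curves and unit speed -/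

/-- The fundamental theorem of calculus for Lipschitz functions with values in the plane. -/
theorem LipschitzWith.integral_deriv_eq_sub_complex {f : ℝ → ℂ} {K : ℝ≥0} (hf : LipschitzWith K f)
    (a b : ℝ) : ∫ x in a..b, deriv f x = f b - f a := by
  have hd : ∀ᵐ x, DifferentiableAt ℝ f x := hf.ae_differentiableAt_real
  have hint : ∀ x y, IntervalIntegrable (deriv f) volume x y := fun x y => by
    refine (intervalIntegrable_const (c := (K : ℝ))).mono_fun
      (measurable_deriv f).aestronglyMeasurable (Eventually.of_forall fun x => ?_)
    simpa using norm_deriv_le_of_lipschitz hf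
  set g : ℝ → ℂ := f - fun x => ∫ t in a..x, deriv f t with hg
  have hprim : LipschitzWith K fun x => ∫ t in a..x, deriv f t :=
    LipschitzWith.of_dist_le_mul fun x y => by
      rw [dist_eq_norm, intervalIntegral.integral_interval_sub_left (hint a x) (hint a y),
        Real.dist_eq]
      exact intervalIntegral.norm_integral_le_of_norm_le_const
        fun z _ => norm_deriv_le_of_lipschitz hf
  have hac : AbsolutelyContinuousOnInterval g a b :=
    hf.lipschitzOnWith.absolutelyContinuousOnInterval.sub
      hprim.lipschitzOnWith.absolutelyContinuousOnInterval
  have hzero : ∀ᵐ x, x ∈ uIcc a b → HasDerivAt g 0 x := by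
    filter_upwards [hd, (hint a b).ae_hasDerivAt_integral] with x hx₁ hx₂ hx₃
    have := hx₁.hasDerivAt.sub (hx₂ hx₃ a left_mem_uIcc)
    rwa [sub_self] at this
  obtain ⟨C, hC⟩ := hac.const_of_ae_hasDerivAt_zero hzero
  have h : g a = g b := (hC a left_mem_uIcc).trans (hC b right_mem_uIcc).symm
  simp only [hg, Pi.sub_apply, intervalIntegral.integral_same, sub_zero] at h
  rw [h]
  ring

/-- The variation of a Lipschitz curve is at most the integral of its speed. -/
theorem LipschitzWith.eVariationOn_Icc_le_integral_norm_deriv {f : ℝ → ℂ} {K : ℝ≥0}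
    (hf : LipschitzWith K f) (a b : ℝ) :
    eVariationOn f (Icc a b) ≤ ENNReal.ofReal (∫ x in a..b, ‖deriv f x‖) := by
  have hint : ∀ x y, IntervalIntegrable (fun x => ‖deriv f x‖) volume x y := fun x y =>
    (intervalIntegrable_const (c := (K : ℝ))).mono_fun
      (measurable_deriv f).norm.aestronglyMeasurable
      (Eventually.of_forall fun x => by simpa using norm_deriv_le_of_lipschitz hf)
  refine iSup_le fun p => ?_
  obtain ⟨n, u, hu, hus⟩ := p
  have hle : ∀ i, edist (f (u (i + 1))) (f (u i)) ≤
      ENNReal.ofReal (∫ x in u i..u (i + 1), ‖deriv f x‖) := fun i => by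
    rw [edist_dist, dist_eq_norm, ← hf.integral_deriv_eq_sub_complex]
    exact ENNReal.ofReal_le_ofReal
      (intervalIntegral.norm_integral_le_integral_norm (hu (Nat.le_succ i)))
  refine (Finset.sum_le_sum fun i _ => hle i).trans ?_
  rw [← ENNReal.ofReal_sum_of_nonneg fun i _ =>
    intervalIntegral.integral_nonneg (hu (Nat.le_succ i)) fun _ _ => norm_nonneg _,
    intervalIntegral.sum_integral_adjacent_intervals fun i _ => hint _ _]
  refine ENNReal.ofReal_le_ofReal (intervalIntegral.integral_mono_interval (hus 0).1
    (hu (Nat.zero_le n)) (hus n).2 (Eventually.of_forall fun _ => norm_nonneg _) (hint a b))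

/-- A plane curve of unit speed, in the sense that subarcs over `[x, y]` have length `y - x`, has
a derivative of modulus one almost everywhere. -/
theorem HasUnitSpeedOn.ae_norm_deriv_eq_one {f : ℝ → ℂ} {a b : ℝ} (hab : a ≤ b)
    (hf : HasUnitSpeedOn f (Icc a b)) (hlip : LipschitzOnWith 1 f (Icc a b)) :
    ∀ᵐ s ∂volume.restrict (Icc a b), ‖deriv f s‖ = 1 := by
  -- `F` is a globally Lipschitz extension of `f`, with the same derivative on the open interval.
  set F : ℝ → ℂ := IccExtend hab ((Icc a b).domRestrict f) with hF
  have hFlip : LipschitzWith 1 F := by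
    have := hlip.to_restrict.comp (LipschitzWith.projIcc hab)
    rwa [mul_one] at this
  have hFf : EqOn F f (Icc a b) := fun x hx => by
    simp [hF, IccExtend_of_mem hab _ hx]
  have hderiv : ∀ x ∈ Ioo a b, deriv F x = deriv f x := fun x hx =>
    (hFf.eventuallyEq_of_mem (Icc_mem_nhds hx.1 hx.2)).deriv_eq
  have hFle : ∀ x, ‖deriv F x‖ ≤ 1 := fun x => by
    simpa using norm_deriv_le_of_lipschitz hFlip (x₀ := x)
  have hint : IntervalIntegrable (fun x => ‖deriv F x‖) volume a b :=
    (intervalIntegrable_const (c := (1 : ℝ))).mono_fun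
      (measurable_deriv F).norm.aestronglyMeasurable
      (Eventually.of_forall fun x => by simpa using hFle x)
  have hlen : b - a ≤ ∫ x in a..b, ‖deriv F x‖ := by
    have h1 := hFlip.eVariationOn_Icc_le_integral_norm_deriv a b
    have h2 := hf (left_mem_Icc.2 hab) (right_mem_Icc.2 hab)
    rw [inter_self, ← eVariationOn.congr hFf, NNReal.coe_one, one_mul] at h2
    rw [h2] at h1
    exact (ENNReal.ofReal_le_ofReal_iff
      (intervalIntegral.integral_nonneg hab fun _ _ => norm_nonneg _)).1 h1
  have hzero : ∫ x in a..b, (1 - ‖deriv F x‖) = 0 := by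
    refine le_antisymm ?_ (intervalIntegral.integral_nonneg hab fun x _ => sub_nonneg.2 (hFle x))
    rw [intervalIntegral.integral_sub intervalIntegrable_const hint]
    simpa using hlen
  rw [intervalIntegral.integral_eq_zero_iff_of_le_of_nonneg_ae hab
    (Eventually.of_forall fun x => sub_nonneg.2 (hFle x)) (intervalIntegrable_const.sub hint)]
    at hzero
  rw [← Measure.restrict_congr_set Ioo_ae_eq_Icc]
  rw [← Measure.restrict_congr_set Ioo_ae_eq_Ioc] at hzero
  filter_upwards [hzero, ae_restrict_mem measurableSet_Ioo] with x hx hxm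
  rw [← hderiv x hxm]
  have : 1 - ‖deriv F x‖ = 0 := hx
  linarith

/-- The variation function of a continuous function of bounded variation is continuous. -/
theorem variationOnFromTo.continuousOn {E : Type*} [PseudoMetricSpace E] {f : ℝ → E} {s : Set ℝ}
    (hf : LocallyBoundedVariationOn f s) (hc : ContinuousOn f s) {a : ℝ} (ha : a ∈ s) :
    ContinuousOn (variationOnFromTo f s a) s := fun x hx => by
  have hl := variationOnFromTo.tendsto_left ha hx hf ((hc x hx).mono inter_subset_left)
  have hr := variationOnFromTo.tendsto_right ha hx hf ((hc x hx).mono inter_subset_left)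
  rw [dist_self, sub_zero] at hl
  rw [dist_self, add_zero] at hr
  have h : ContinuousWithinAt (variationOnFromTo f s a) ((s ∩ Iio x) ∪ (s ∩ Ioi x)) x :=
    continuousWithinAt_union.2 ⟨hl, hr⟩
  refine (continuousWithinAt_insert_self.2 h).mono fun y hy => ?_
  rcases lt_trichotomy y x with h | h | h
  · exact Or.inr (Or.inl ⟨hy, h⟩)
  · exact Or.inl h
  · exact Or.inr (Or.inr ⟨hy, h⟩)

/-! ### Geometry of the arc-length parametrization -/

namespace RectifiableJordanCurve

variable (Γ : RectifiableJordanCurve)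

theorem isCompact_carrier : IsCompact Γ.carrier :=
  isCompact_Icc.image_of_continuousOn Γ.continuousOn

theorem length_nonneg : 0 ≤ Γ.length := ENNReal.toReal_nonneg

theorem variationOnFromTo_zero_one :
    variationOnFromTo Γ.toFun (Icc 0 1) 0 1 = Γ.length := by
  rw [variationOnFromTo.eq_of_le _ _ zero_le_one, inter_self, length]

theorem image_variationOnFromTo :
    variationOnFromTo Γ.toFun (Icc 0 1) 0 '' Icc 0 1 = Icc 0 Γ.length := by
  have hloc := Γ.boundedVariationOn.locallyBoundedVariationOn
  have h0 : (0 : ℝ) ∈ Icc (0 : ℝ) 1 := left_mem_Icc.2 zero_le_one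
  have h1 : (1 : ℝ) ∈ Icc (0 : ℝ) 1 := right_mem_Icc.2 zero_le_one
  have hmono := variationOnFromTo.monotoneOn hloc h0
  refine Subset.antisymm ?_ ?_
  · rintro _ ⟨x, hx, rfl⟩
    have hl := hmono h0 hx hx.1
    have hr := hmono hx h1 hx.2
    rw [variationOnFromTo.self] at hl
    rw [variationOnFromTo_zero_one] at hr
    exact ⟨hl, hr⟩
  · have := intermediate_value_Icc zero_le_one
      (variationOnFromTo.continuousOn hloc Γ.continuousOn h0)
    rwa [variationOnFromTo.self, variationOnFromTo_zero_one] at this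

theorem arcParam_variationOnFromTo {x : ℝ} (hx : x ∈ Icc (0 : ℝ) 1) :
    Γ.arcParam (variationOnFromTo Γ.toFun (Icc 0 1) 0 x) = Γ.toFun x :=
  edist_eq_zero.1 (edist_naturalParameterization_eq_zero
    Γ.boundedVariationOn.locallyBoundedVariationOn (left_mem_Icc.2 zero_le_one) hx)

theorem arcParam_image : Γ.arcParam '' Icc 0 Γ.length = Γ.carrier := by
  rw [← image_variationOnFromTo, image_image, carrier]
  exact image_congr fun x hx => Γ.arcParam_variationOnFromTo hx

theorem arcParam_injOn : InjOn Γ.arcParam (Ico 0 Γ.length) := by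
  have key : ∀ s ∈ Ico 0 Γ.length, ∃ x ∈ Ico (0 : ℝ) 1,
      variationOnFromTo Γ.toFun (Icc 0 1) 0 x = s := fun s hs => by
    have hs' : s ∈ variationOnFromTo Γ.toFun (Icc 0 1) 0 '' Icc 0 1 := by
      rw [image_variationOnFromTo]; exact Ico_subset_Icc_self hs
    obtain ⟨x, hx, rfl⟩ := hs'
    refine ⟨x, ⟨hx.1, hx.2.lt_of_ne ?_⟩, rfl⟩
    rintro rfl
    exact hs.2.ne Γ.variationOnFromTo_zero_one
  intro s hs s' hs' h
  obtain ⟨x, hx, rfl⟩ := key s hs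
  obtain ⟨y, hy, rfl⟩ := key s' hs'
  rw [Γ.arcParam_variationOnFromTo (Ico_subset_Icc_self hx),
    Γ.arcParam_variationOnFromTo (Ico_subset_Icc_self hy)] at h
  rw [Γ.injOn hx hy h]

theorem arcParam_hasUnitSpeedOn : HasUnitSpeedOn Γ.arcParam (Icc 0 Γ.length) := by
  rw [← image_variationOnFromTo]
  exact has_unit_speed_naturalParameterization _
    Γ.boundedVariationOn.locallyBoundedVariationOn (left_mem_Icc.2 zero_le_one)

theorem arcParam_lipschitzOnWith : LipschitzOnWith 1 Γ.arcParam (Icc 0 Γ.length) := by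
  have key : ∀ x ∈ Icc 0 Γ.length, ∀ y ∈ Icc 0 Γ.length, x ≤ y →
      edist (Γ.arcParam x) (Γ.arcParam y) ≤ edist x y := fun x hx y hy hxy => by
    have h := Γ.arcParam_hasUnitSpeedOn hx hy
    rw [NNReal.coe_one, one_mul] at h
    rw [edist_comm x y, edist_dist y x, Real.dist_eq, abs_of_nonneg (sub_nonneg.2 hxy), ← h]
    exact eVariationOn.edist_le _ ⟨hx, le_rfl, hxy⟩ ⟨hy, hxy, le_rfl⟩
  intro x hx y hy
  rw [ENNReal.coe_one, one_mul]
  rcases le_total x y with h | h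
  · exact key x hx y hy h
  · rw [edist_comm, edist_comm x]
    exact key y hy x hx h

theorem aemeasurable_arcParam :
    AEMeasurable Γ.arcParam (volume.restrict (Icc 0 Γ.length)) :=
  Γ.arcParam_lipschitzOnWith.continuousOn.aemeasurable measurableSet_Icc

instance : IsFiniteMeasure Γ.lengthMeasure :=
  inferInstanceAs (IsFiniteMeasure ((volume.restrict (Icc 0 Γ.length)).map Γ.arcParam))

/-- The conjugate of the unit tangent vector, as a function on the plane: multiplication by it
turns the complex line element `dτ` into the length element `|dτ|`. -/
theorem exists_conj_tangent : ∃ θ : ℂ → ℂ, Measurable θ ∧ (∀ τ, ‖θ τ‖ ≤ 1) ∧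
    ∀ᵐ s ∂volume.restrict (Icc 0 Γ.length), θ (Γ.arcParam s) * deriv Γ.arcParam s = 1 := by
  -- `Γ.arcParam` is a Borel isomorphism of `[0, |Γ|)` onto its image, so that a Borel function of
  -- the arc length is a Borel function of the point of the curve.
  have hemb := Γ.arcParam_lipschitzOnWith.continuousOn.mono Ico_subset_Icc_self
    |>.measurableEmbedding measurableSet_Ico Γ.arcParam_injOn
  obtain ⟨η, hη, hηe⟩ := hemb.exists_measurable_extend
    (g := fun s => (starRingEnd ℂ) (deriv Γ.arcParam s))
    ((Complex.continuous_conj.measurable.comp (measurable_deriv _)).comp measurable_subtype_coe)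
    fun _ => ⟨0⟩
  refine ⟨fun τ => if ‖η τ‖ ≤ 1 then η τ else 0,
    Measurable.ite (measurableSet_le hη.norm measurable_const) hη measurable_const, fun τ => ?_, ?_⟩
  · dsimp only
    split_ifs with h
    · exact h
    · simp
  have hone := Γ.arcParam_hasUnitSpeedOn.ae_norm_deriv_eq_one Γ.length_nonneg
    Γ.arcParam_lipschitzOnWith
  rw [← Measure.restrict_congr_set Ico_ae_eq_Icc] at hone ⊢
  filter_upwards [hone, ae_restrict_mem measurableSet_Ico] with s hs hsm
  have h : η (Γ.arcParam s) = (starRingEnd ℂ) (deriv Γ.arcParam s) := congrFun hηe ⟨s, hsm⟩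
  rw [h, if_pos (by rw [RCLike.norm_conj, hs]), mul_comm, Complex.mul_conj,
    Complex.normSq_eq_norm_sq, hs]
  norm_num

/-- A contour integral against the conjugate tangent is an integral against the length measure. -/
theorem contourIntegral_mul_eq_integral {θ : ℂ → ℂ}
    (hθ : ∀ᵐ s ∂volume.restrict (Icc 0 Γ.length), θ (Γ.arcParam s) * deriv Γ.arcParam s = 1)
    {h : ℂ → ℂ} (hh : AEStronglyMeasurable h Γ.lengthMeasure) :
    Γ.contourIntegral (fun τ => h τ * θ τ) = ∫ τ, h τ ∂Γ.lengthMeasure := by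
  rw [contourIntegral, intervalIntegral.integral_of_le Γ.length_nonneg, lengthMeasure,
    integral_map Γ.aemeasurable_arcParam hh, ← integral_Icc_eq_integral_Ioc]
  refine integral_congr_ae ?_
  filter_upwards [hθ] with s hs
  rw [mul_assoc, hs, mul_one]

/-- The curve has to cross every annulus about one of its points that it leaves, so that its
length in the annulus is at least the width of the annulus. -/
theorem ofReal_sub_le_lengthMeasure_annulus {t q : ℂ} (ht : t ∈ Γ.carrier) (hq : q ∈ Γ.carrier)
    {a b : ℝ} (ha : 0 ≤ a) (hb : b ≤ ‖q - t‖) :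
    ENNReal.ofReal (b - a) ≤
      Γ.lengthMeasure (Γ.carrier ∩ {τ | a ≤ ‖τ - t‖ ∧ ‖τ - t‖ < b}) := by
  have hmeas : MeasurableSet (Γ.carrier ∩ {τ | a ≤ ‖τ - t‖ ∧ ‖τ - t‖ < b}) := by
    refine Γ.isCompact_carrier.measurableSet.inter (MeasurableSet.inter ?_ ?_)
    · exact (isClosed_le continuous_const
        (by fun_prop : Continuous fun τ : ℂ => ‖τ - t‖)).measurableSet
    · exact (isOpen_lt (by fun_prop : Continuous fun τ : ℂ => ‖τ - t‖)
        continuous_const).measurableSet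
  have hlip : LipschitzOnWith 1 (fun s => ‖Γ.arcParam s - t‖) (Icc 0 Γ.length) :=
    LipschitzOnWith.of_dist_le_mul fun x hx y hy => by
      refine le_trans ?_ (Γ.arcParam_lipschitzOnWith.dist_le_mul x hx y hy)
      simpa [Real.dist_eq, dist_eq_norm] using
        abs_norm_sub_norm_le (Γ.arcParam x - t) (Γ.arcParam y - t)
  set S : Set ℝ := {s | a ≤ ‖Γ.arcParam s - t‖ ∧ ‖Γ.arcParam s - t‖ < b} ∩ Icc 0 Γ.length
  have himage : Ico a b ⊆ (fun s => ‖Γ.arcParam s - t‖) '' S := fun r hr => by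
    rw [← arcParam_image] at ht hq
    obtain ⟨x, hx, rfl⟩ := ht
    obtain ⟨y, hy, rfl⟩ := hq
    have := (isPreconnected_Icc (a := (0 : ℝ)) (b := Γ.length)).intermediate_value hx hy
      hlip.continuousOn
    simp only [sub_self, norm_zero] at this
    obtain ⟨s, hs, rfl⟩ := this ⟨ha.trans hr.1, (hr.2.trans_le hb).le⟩
    exact ⟨s, ⟨hr, hs⟩, rfl⟩
  have hvol : volume ((fun s => ‖Γ.arcParam s - t‖) '' S) ≤ volume S := by
    have := (hlip.mono inter_subset_right : LipschitzOnWith 1 _ S).hausdorffMeasure_image_le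
      (d := 1) zero_le_one
    rwa [hausdorffMeasure_real, ENNReal.coe_one, ENNReal.one_rpow, one_mul] at this
  rw [lengthMeasure, Measure.map_apply_of_aemeasurable Γ.aemeasurable_arcParam hmeas,
    Measure.restrict_apply' measurableSet_Icc, ← Real.volume_Ico]
  refine (measure_mono himage).trans (hvol.trans (measure_mono ?_))
  rintro s ⟨hs, hsI⟩
  exact ⟨⟨Γ.arcParam_image ▸ mem_image_of_mem _ hsI, hs⟩, hsI⟩

theorem exists_pos_forall_exists_le_norm_sub :
    ∃ d > 0, ∀ t : ℂ, ∃ q ∈ Γ.carrier, d ≤ ‖q - t‖ := by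
  have hne : Γ.toFun 0 ≠ Γ.toFun (1 / 2) := fun h => by
    have := Γ.injOn (by norm_num) (by norm_num) h
    norm_num at this
  refine ⟨‖Γ.toFun 0 - Γ.toFun (1 / 2)‖ / 2, half_pos (norm_pos_iff.2 (sub_ne_zero.2 hne)),
    fun t => ?_⟩
  by_contra! h
  have h0 := h _ ⟨0, by norm_num, rfl⟩
  have h1 := h _ ⟨1 / 2, by norm_num, rfl⟩
  have := norm_sub_le_norm_sub_add_norm_sub (Γ.toFun 0) t (Γ.toFun (1 / 2))
  rw [norm_sub_rev t] at this
  linarith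

end RectifiableJordanCurve

/-! ### Banach function norms -/

section BanachFunctionNorm

variable {α : Type*} [MeasurableSpace α] {μ : Measure α} {ρ : (α → ℝ≥0∞) → ℝ≥0∞}

/-- Hölder's inequality for a Banach function norm and its associate norm. -/
theorem IsBanachFunctionNorm.lintegral_mul_le (hρ : IsBanachFunctionNorm μ ρ) {f g : α → ℝ≥0∞}
    (hf : AEMeasurable f μ) (hfin : ρ f ≠ ∞) :
    ∫⁻ x, f x * g x ∂μ ≤ ρ f * associateNorm μ ρ g := by
  by_cases h0 : ρ f = 0
  · have hf0 := (hρ.eq_zero_iff f hf).1 h0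
    have : ∫⁻ x, f x * g x ∂μ = 0 := by
      rw [lintegral_congr_ae (g := 0) (by filter_upwards [hf0] with x hx; simp [hx])]
      simp
    rw [this]
    exact zero_le
  · lift ρ f to ℝ≥0 using hfin with c hc
    have hc0 : c ≠ 0 := by simpa using h0
    have hmeas : AEMeasurable (fun x => (c⁻¹ : ℝ≥0) * f x) μ := hf.const_mul _
    have hle : ∫⁻ x, (c⁻¹ : ℝ≥0) * f x * g x ∂μ ≤ associateNorm μ ρ g := by
      refine le_iSup₂ (f := fun (f : α → ℝ≥0∞) (_ : AEMeasurable f μ ∧ ρ f ≤ 1) =>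
        ∫⁻ x, f x * g x ∂μ) (fun x => (c⁻¹ : ℝ≥0) * f x) ⟨hmeas, ?_⟩
      rw [hρ.smul _ f hf, ← hc, ← ENNReal.coe_mul, inv_mul_cancel₀ hc0, ENNReal.coe_one]
    simp_rw [mul_assoc] at hle
    rw [lintegral_const_mul' _ _ ENNReal.coe_ne_top] at hle
    calc ∫⁻ x, f x * g x ∂μ = c * ((c⁻¹ : ℝ≥0) * ∫⁻ x, f x * g x ∂μ) := by
          rw [← mul_assoc, ← ENNReal.coe_mul, mul_inv_cancel₀ hc0, ENNReal.coe_one, one_mul]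
      _ ≤ c * associateNorm μ ρ g := by gcongr

theorem associateNorm_mono {g h : α → ℝ≥0∞} (hgh : g ≤ h) :
    associateNorm μ ρ g ≤ associateNorm μ ρ h :=
  iSup₂_mono fun _ _ => lintegral_mono fun x => by gcongr; exact hgh x

theorem associateNorm_add_le {g h : α → ℝ≥0∞} (hg : AEMeasurable g μ) :
    associateNorm μ ρ (g + h) ≤ associateNorm μ ρ g + associateNorm μ ρ h := by
  refine iSup₂_le fun f hf => ?_
  simp only [Pi.add_apply, mul_add]
  rw [lintegral_add_left' (f := fun x => f x * g x) (hf.1.mul hg)]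
  gcongr
  · exact le_iSup₂ (f := fun (f : α → ℝ≥0∞) (_ : AEMeasurable f μ ∧ ρ f ≤ 1) =>
      ∫⁻ x, f x * g x ∂μ) f hf
  · exact le_iSup₂ (f := fun (f : α → ℝ≥0∞) (_ : AEMeasurable f μ ∧ ρ f ≤ 1) =>
      ∫⁻ x, f x * h x ∂μ) f hf

theorem measure_eq_zero_of_indicator_ae_eq_zero {s : Set α} {w : α → ℝ≥0∞}
    (hw : ∀ᵐ x ∂μ, w x ≠ 0) (h : s.indicator w =ᵐ[μ] 0) : μ s = 0 := by
  rw [← compl_compl s, ← mem_ae_iff]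
  filter_upwards [hw, h] with x hx hx0 hxs
  rw [indicator_of_mem hxs] at hx0
  exact hx hx0

theorem IsBanachFunctionNorm.indicator_ne_zero (hρ : IsBanachFunctionNorm μ ρ) {s : Set α}
    (hs : MeasurableSet s) (hμs : μ s ≠ 0) {w : α → ℝ≥0∞} (hw : AEMeasurable w μ)
    (hw0 : ∀ᵐ x ∂μ, w x ≠ 0) : ρ (s.indicator w) ≠ 0 := fun h =>
  hμs (measure_eq_zero_of_indicator_ae_eq_zero hw0
    ((hρ.eq_zero_iff _ (hw.indicator hs)).1 h))

theorem IsBanachFunctionNorm.associateNorm_indicator_ne_zero (hρ : IsBanachFunctionNorm μ ρ)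
    {s : Set α} (hs : MeasurableSet s) (hμs : μ s ≠ 0) {w : α → ℝ≥0∞} (hw : AEMeasurable w μ)
    (hw0 : ∀ᵐ x ∂μ, w x ≠ 0) : associateNorm μ ρ (s.indicator w) ≠ 0 := fun h => by
  have h1 := hρ.lintegral_mul_le (f := univ.indicator 1) (g := s.indicator w)
    (aemeasurable_one.indicator MeasurableSet.univ)
    (hρ.indicator_lt_top univ MeasurableSet.univ.nullMeasurableSet).ne
  rw [h, mul_zero, nonpos_iff_eq_zero] at h1
  simp only [indicator_univ, Pi.one_apply, one_mul] at h1
  rw [lintegral_eq_zero_iff' (hw.indicator hs)] at h1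
  exact hμs (measure_eq_zero_of_indicator_ae_eq_zero hw0 h1)

end BanachFunctionNorm

/-! ### Testing the Cauchy singular integral on separated pieces of the curve -/

namespace RectifiableJordanCurve

variable (Γ : RectifiableJordanCurve)

theorem measurableSet_portion (t : ℂ) (R : ℝ) : MeasurableSet (Γ.portion t R) :=
  Γ.isCompact_carrier.measurableSet.inter
    (isOpen_lt (by fun_prop : Continuous fun τ : ℂ => ‖τ - t‖) continuous_const).measurableSet

/-- Away from the support of the density the truncations are eventually constant. -/
theorem truncatedCauchy_eq {f : ℂ → ℂ} {z : ℂ} {δ R : ℝ} (hR : R ≤ δ)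
    (hf : ∀ τ ∈ Γ.carrier, f τ ≠ 0 → δ ≤ ‖τ - z‖) :
    Γ.truncatedCauchy f z R =
      1 / (Real.pi * Complex.I) * Γ.contourIntegral fun τ => f τ / (τ - z) := by
  rw [truncatedCauchy, contourIntegral, contourIntegral]
  congr 1
  refine intervalIntegral.integral_congr fun s hs => ?_
  rw [uIcc_of_le Γ.length_nonneg] at hs
  have hmem : Γ.arcParam s ∈ Γ.carrier := Γ.arcParam_image ▸ mem_image_of_mem _ hs
  congr 1
  by_cases h0 : f (Γ.arcParam s) = 0
  · simp [indicator, h0]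
  · exact indicator_of_mem (mem_sdiff_of_mem hmem fun hp =>
      (hp.2.trans_le hR).not_ge (hf _ hmem h0)) _

/-- The constant `C` bounds the norm of the Cauchy singular integral operator on `X_w`, tested on
the integrable functions of `X_w`. -/
def IsCauchyBound (ρ : (ℂ → ℝ≥0∞) → ℝ≥0∞) (w : ℂ → ℝ≥0∞) (C : ℝ≥0) : Prop :=
  ∀ f : ℂ → ℂ, MemWeighted Γ.lengthMeasure ρ w f → Integrable f Γ.lengthMeasure →
    ∃ g : ℂ → ℂ, Γ.IsCauchySingularIntegral f g ∧ MemWeighted Γ.lengthMeasure ρ w g ∧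
      weightedNorm ρ w g ≤ C * weightedNorm ρ w f

variable {Γ} {ρ : (ℂ → ℝ≥0∞) → ℝ≥0∞} {w : ℂ → ℝ≥0∞}

/-- The operator norm bound tested on a density `h u θ`, where `h ≥ 0` is bounded and supported on
`P`, `θ` is the conjugate tangent and the phase `u` makes the Cauchy kernel, up to the phase
`v` depending on the other variable only, have real part at least `c` on `P × Q`. -/
theorem rho_indicator_mul_lintegral_le (hρ : IsBanachFunctionNorm Γ.lengthMeasure ρ)
    (hw : IsWeight Γ.lengthMeasure w) {C : ℝ≥0}
    (hS : Γ.IsCauchyBound ρ w C)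
    {P Q : Set ℂ} (hQ : MeasurableSet Q)
    {u v : ℂ → ℂ} (hu : Measurable u) (hu1 : ∀ τ, ‖u τ‖ ≤ 1) (hv1 : ∀ z, ‖v z‖ ≤ 1)
    {c δ : ℝ} (hc : 0 < c) (hδ : 0 < δ) (hsep : ∀ τ ∈ P, ∀ z ∈ Q, δ ≤ ‖τ - z‖)
    (hker : ∀ τ ∈ P, ∀ z ∈ Q, c ≤ (v z * u τ / (τ - z)).re)
    {h : ℂ → ℝ≥0} (hh : Measurable h) {M : ℝ≥0} (hM : ∀ τ, h τ ≤ M) (hsupp : ∀ τ ∉ P, h τ = 0)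
    (hnorm : ρ (fun τ => h τ * w τ) ≤ 1) :
    ρ (Q.indicator w) * ∫⁻ τ, h τ ∂Γ.lengthMeasure ≤ C * ENNReal.ofReal (Real.pi / c) := by
  obtain ⟨θ, hθm, hθ1, hθ⟩ := Γ.exists_conj_tangent
  set f : ℂ → ℂ := fun τ => h τ * u τ * θ τ with hf
  have hhm : Measurable fun τ => ((h τ : ℝ) : ℂ) :=
    Complex.measurable_ofReal.comp (measurable_coe_nnreal_real.comp hh)
  have hfm : Measurable f := (hhm.mul hu).mul hθm
  have hnormu : ∀ τ, ‖((h τ : ℝ) : ℂ) * u τ‖ ≤ h τ := fun τ => by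
    rw [norm_mul, Complex.norm_real, NNReal.norm_eq]
    exact mul_le_of_le_one_right (h τ).2 (hu1 τ)
  have hfn : ∀ τ, ‖f τ‖ ≤ h τ := fun τ => by
    rw [hf]
    simp only [norm_mul _ (θ τ)]
    exact (mul_le_of_le_one_right (norm_nonneg _) (hθ1 τ)).trans (hnormu τ)
  have hfnorm : weightedNorm ρ w f ≤ 1 := by
    refine (hρ.mono _ _ (hh.coe_nnreal_ennreal.aemeasurable.mul hw.1)
      (hfm.enorm.aemeasurable.mul hw.1) (Eventually.of_forall fun τ => ?_)).trans hnorm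
    have : ‖f τ‖ₑ ≤ h τ := by
      rw [enorm_eq_nnnorm]
      exact_mod_cast hfn τ
    exact mul_le_mul_left this _
  have hfi : Integrable f Γ.lengthMeasure := Integrable.of_bound hfm.aestronglyMeasurable (M : ℝ)
    (Eventually.of_forall fun τ => (hfn τ).trans (by exact_mod_cast hM τ))
  obtain ⟨g, hg, hgm, hgC⟩ :=
    hS f ⟨hfm.aestronglyMeasurable, hfnorm.trans_lt ENNReal.one_lt_top⟩ hfi
  have hint : Integrable (fun τ => (h τ : ℝ)) Γ.lengthMeasure :=
    Integrable.of_bound (measurable_coe_nnreal_real.comp hh).aestronglyMeasurable (M : ℝ)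
      (Eventually.of_forall fun τ => by simpa using hM τ)
  -- The singular integral of `f` is bounded below on `Q`.
  have hlower : ∀ᵐ z ∂Γ.lengthMeasure, z ∈ Q →
      c / Real.pi * ∫ τ, (h τ : ℝ) ∂Γ.lengthMeasure ≤ ‖g z‖ := by
    filter_upwards [hg] with z hz hzQ
    have hkm : Measurable fun τ => (h τ : ℂ) * u τ / (τ - z) :=
      (hhm.mul hu).div (measurable_id.sub_const z)
    have hcongr : (fun τ => f τ / (τ - z)) = fun τ => (h τ : ℂ) * u τ / (τ - z) * θ τ := by
      ext τ; rw [hf]; ring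
    have hgz : g z = 1 / (Real.pi * Complex.I) *
        ∫ τ, (h τ : ℂ) * u τ / (τ - z) ∂Γ.lengthMeasure := by
      rw [← Γ.contourIntegral_mul_eq_integral hθ hkm.aestronglyMeasurable, ← hcongr]
      refine tendsto_nhds_unique hz (tendsto_const_nhds.congr' ?_)
      filter_upwards [Ioc_mem_nhdsGT hδ] with R hR
      refine (Γ.truncatedCauchy_eq hR.2 fun τ _ hτ => hsep τ ?_ z hzQ).symm
      by_contra hτP
      exact hτ (by simp [hf, hsupp τ hτP])
    have hki : Integrable (fun τ => (h τ : ℂ) * u τ / (τ - z)) Γ.lengthMeasure := by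
      refine Integrable.of_bound hkm.aestronglyMeasurable (M / δ)
        (Eventually.of_forall fun τ => ?_)
      by_cases hτ : τ ∈ P
      · rw [norm_div]
        exact div_le_div₀ M.2 ((hnormu τ).trans (by exact_mod_cast hM τ)) hδ (hsep τ hτ z hzQ)
      · simp [hsupp τ hτ]
        positivity
    have hre : c * ∫ τ, (h τ : ℝ) ∂Γ.lengthMeasure ≤
        (v z * ∫ τ, (h τ : ℂ) * u τ / (τ - z) ∂Γ.lengthMeasure).re := by
      rw [← integral_const_mul, ← integral_const_mul]
      have := integral_re (𝕜 := ℂ) (hki.const_mul (v z))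
      simp only [RCLike.re_to_complex] at this
      rw [← this]
      refine integral_mono (hint.const_mul c) (hki.const_mul (v z)).re fun τ => ?_
      by_cases hτ : τ ∈ P
      · have heq : v z * ((h τ : ℂ) * u τ / (τ - z)) = (h τ : ℝ) * (v z * u τ / (τ - z)) := by
          ring
        change c * (h τ : ℝ) ≤ (v z * ((h τ : ℂ) * u τ / (τ - z))).re
        rw [heq, Complex.re_ofReal_mul, mul_comm]
        exact mul_le_mul_of_nonneg_left (hker τ hτ z hzQ) (h τ).2
      · simp [hsupp τ hτ]
    have hnormg : ‖g z‖ = 1 / Real.pi *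
        ‖∫ τ, (h τ : ℂ) * u τ / (τ - z) ∂Γ.lengthMeasure‖ := by
      rw [hgz, norm_mul]
      simp [abs_of_pos Real.pi_pos]
    have hvle := (hre.trans (Complex.re_le_norm _)).trans
      ((norm_mul_le _ _).trans (mul_le_of_le_one_left (norm_nonneg _) (hv1 z)))
    rw [hnormg, div_mul_eq_mul_div, div_eq_inv_mul, one_div]
    exact mul_le_mul_of_nonneg_left hvle (inv_nonneg.2 Real.pi_pos.le)
  -- Apply `ρ` to this lower bound, multiplied by the weight.
  set a : ℝ := c / Real.pi * ∫ τ, (h τ : ℝ) ∂Γ.lengthMeasure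
  have hρa : ENNReal.ofReal a * ρ (Q.indicator w) ≤ C := by
    have hQw : AEMeasurable (Q.indicator w) Γ.lengthMeasure := hw.1.indicator hQ
    have : ρ (fun z => (a.toNNReal : ℝ≥0∞) * Q.indicator w z) ≤ weightedNorm ρ w g := by
      refine hρ.mono _ _ (hgm.1.enorm.mul hw.1) (hQw.const_mul _) ?_
      filter_upwards [hlower] with z hz
      by_cases hzQ : z ∈ Q
      · rw [indicator_of_mem hzQ]
        refine mul_le_mul_left ?_ _
        rw [← ofReal_norm]
        exact ENNReal.ofReal_le_ofReal (hz hzQ)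
      · simp [hzQ]
    rw [hρ.smul _ _ hQw] at this
    refine this.trans (hgC.trans ?_)
    exact (mul_le_mul_right hfnorm _).trans (mul_one _).le
  have hcpi : 0 < c / Real.pi := div_pos hc Real.pi_pos
  have hlint : ENNReal.ofReal a = ENNReal.ofReal (c / Real.pi) * ∫⁻ τ, h τ ∂Γ.lengthMeasure := by
    rw [ENNReal.ofReal_mul hcpi.le, ofReal_integral_eq_lintegral_ofReal hint
      (Eventually.of_forall fun τ => (h τ).2)]
    simp
  calc ρ (Q.indicator w) * ∫⁻ τ, h τ ∂Γ.lengthMeasure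
      = ENNReal.ofReal (Real.pi / c) * (ENNReal.ofReal a * ρ (Q.indicator w)) := by
        rw [hlint, ← mul_assoc, ← mul_assoc, ← ENNReal.ofReal_mul (by positivity),
          div_mul_div_cancel₀ hc.ne', div_self Real.pi_ne_zero, ENNReal.ofReal_one, one_mul,
          mul_comm]
    _ ≤ C * ENNReal.ofReal (Real.pi / c) := by
        rw [mul_comm (C : ℝ≥0∞)]
        gcongr

/-- A bounded singular integral operator controls the product of the norms over two separated sets
on which the phase of the Cauchy kernel can be compensated in each variable: the supremum over
`h` of the bound `rho_indicator_mul_lintegral_le`, with `h` approximating `f χ_P / w`. -/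
theorem rho_indicator_mul_associateNorm_le (hρ : IsBanachFunctionNorm Γ.lengthMeasure ρ)
    (hw : IsWeight Γ.lengthMeasure w) {C : ℝ≥0}
    (hS : Γ.IsCauchyBound ρ w C)
    {P Q : Set ℂ} (hP : MeasurableSet P) (hQ : MeasurableSet Q)
    {u v : ℂ → ℂ} (hu : Measurable u) (hu1 : ∀ τ, ‖u τ‖ ≤ 1) (hv1 : ∀ z, ‖v z‖ ≤ 1)
    {c δ : ℝ} (hc : 0 < c) (hδ : 0 < δ) (hsep : ∀ τ ∈ P, ∀ z ∈ Q, δ ≤ ‖τ - z‖)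
    (hker : ∀ τ ∈ P, ∀ z ∈ Q, c ≤ (v z * u τ / (τ - z)).re) :
    ρ (Q.indicator w) * associateNorm Γ.lengthMeasure ρ (P.indicator fun τ => (w τ)⁻¹) ≤
      C * ENNReal.ofReal (Real.pi / c) := by
  simp only [associateNorm, ENNReal.mul_iSup]
  refine iSup₂_le fun f hf => ?_
  have hFm : AEMeasurable (fun τ => f τ * P.indicator (fun τ => (w τ)⁻¹) τ) Γ.lengthMeasure :=
    hf.1.mul (hw.1.inv.indicator hP)
  set F := hFm.mk
  have hF : Measurable F := hFm.measurable_mk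
  -- Bounded densities that increase to `F` on `P`.
  set h : ℕ → ℂ → ℝ≥0 := fun n => P.indicator fun τ => (min (F τ) n).toNNReal with hh
  have hcoe : ∀ n τ, ((h n τ : ℝ≥0) : ℝ≥0∞) = P.indicator (fun τ => min (F τ) n) τ :=
    fun n τ => by
    by_cases hτ : τ ∈ P
    · simp only [hh, indicator_of_mem hτ]
      exact ENNReal.coe_toNNReal ((min_le_right _ _).trans_lt (ENNReal.natCast_lt_top n)).ne
    · simp [hh, hτ]
  have hbound : ∀ n, ρ (Q.indicator w) * ∫⁻ τ, h n τ ∂Γ.lengthMeasure ≤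
      C * ENNReal.ofReal (Real.pi / c) := fun n => by
    have hhm : Measurable (h n) := (hF.min measurable_const).ennreal_toNNReal.indicator hP
    refine rho_indicator_mul_lintegral_le hρ hw hS hQ hu hu1 hv1 hc hδ hsep hker
      hhm (M := n) (fun τ => ?_) (fun τ hτ => by simp [hh, hτ]) ?_
    · rw [← ENNReal.coe_le_coe, hcoe]
      exact (indicator_le_self _ _ τ).trans (by simp)
    · refine (hρ.mono f _ hf.1 (hhm.coe_nnreal_ennreal.aemeasurable.mul hw.1) ?_).trans hf.2
      filter_upwards [hFm.ae_eq_mk, hw.2] with τ hτ hwτ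
      rw [Pi.mul_apply, hcoe]
      by_cases hτP : τ ∈ P
      · rw [indicator_of_mem hτP] at hτ ⊢
        calc min (F τ) n * w τ ≤ f τ * (w τ)⁻¹ * w τ := by
              rw [hτ]; gcongr; exact min_le_left _ _
          _ = f τ := by rw [mul_assoc, ENNReal.inv_mul_cancel hwτ.1.ne' hwτ.2.ne, mul_one]
      · simp [hτP]
  have hsup : ∀ τ, f τ * P.indicator (fun τ => (w τ)⁻¹) τ = F τ →
      f τ * P.indicator (fun τ => (w τ)⁻¹) τ = ⨆ n, ((h n τ : ℝ≥0) : ℝ≥0∞) := fun τ hτ => by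
    simp only [hcoe]
    by_cases hτP : τ ∈ P
    · simp only [indicator_of_mem hτP] at hτ ⊢
      rw [hτ, ← inf_iSup_eq, ENNReal.iSup_natCast, inf_top_eq]
    · simp [hτP]
  have hmono : Monotone fun n τ => ((h n τ : ℝ≥0) : ℝ≥0∞) := fun m n hmn τ => by
    dsimp only
    rw [hcoe, hcoe]
    refine indicator_le_indicator ?_
    gcongr
  rw [lintegral_congr_ae (hFm.ae_eq_mk.mono hsup), lintegral_iSup (fun n =>
    ((hF.min measurable_const).ennreal_toNNReal.indicator hP).coe_nnreal_ennreal) hmono,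
    ENNReal.mul_iSup]
  exact iSup_le hbound

/-! ### The Muckenhoupt condition -/

/-- If `p` is at distance between `3R` and `4R` from `t` and `q` is within `R` of `t`, then `p - q`
has nearly the argument of `p - t`. -/
theorem inv_le_re_phase_div {t p q : ℂ} {R : ℝ} (hR : 0 < R) (hp : 3 * R ≤ ‖p - t‖)
    (hp' : ‖p - t‖ < 4 * R) (hq : ‖q - t‖ < R) :
    1 / (8 * R) ≤ ((p - t) / ‖p - t‖ / (p - q)).re := by
  have hpt : 0 < ‖p - t‖ := by linarith
  have hpq : 2 * R ≤ ‖p - q‖ := by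
    have := norm_sub_le_norm_sub_add_norm_sub p q t
    linarith
  have hpq0 : p - q ≠ 0 := norm_pos_iff.1 (by linarith)
  have hsmall : ‖1 - (p - t) / (p - q)‖ ≤ 1 / 2 := by
    have : 1 - (p - t) / (p - q) = -((q - t) / (p - q)) := by field_simp; ring
    rw [this, norm_neg, norm_div, div_le_iff₀ (by linarith)]
    linarith
  have hre : 1 / 2 ≤ ((p - t) / (p - q)).re := by
    have := (Complex.re_le_norm _).trans hsmall
    rw [Complex.sub_re, Complex.one_re] at this
    linarith
  have heq : (p - t) / ‖p - t‖ / (p - q) = ((‖p - t‖⁻¹ : ℝ) : ℂ) * ((p - t) / (p - q)) := by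
    push_cast; ring
  rw [heq, Complex.re_ofReal_mul]
  calc 1 / (8 * R) = (4 * R)⁻¹ * (1 / 2) := by field_simp; norm_num
    _ ≤ ‖p - t‖⁻¹ * ((p - t) / (p - q)).re := by gcongr

/-- The Muckenhoupt condition on small portions, by comparison of the portion with a surrounding
annulus. -/
theorem rho_portion_mul_associateNorm_portion_le (hρ : IsBanachFunctionNorm Γ.lengthMeasure ρ)
    (hw : IsWeight Γ.lengthMeasure w) {C : ℝ≥0}
    (hS : Γ.IsCauchyBound ρ w C)
    {t q : ℂ} {R : ℝ} (hR : 0 < R) (ht : t ∈ Γ.carrier) (hq : q ∈ Γ.carrier)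
    (htq : 4 * R ≤ ‖q - t‖) :
    ρ ((Γ.portion t R).indicator w) ≠ ∞ ∧
    associateNorm Γ.lengthMeasure ρ ((Γ.portion t R).indicator fun τ => (w τ)⁻¹) ≠ ∞ ∧
    ρ ((Γ.portion t R).indicator w) *
      associateNorm Γ.lengthMeasure ρ ((Γ.portion t R).indicator fun τ => (w τ)⁻¹) ≤
      (C * ENNReal.ofReal (8 * Real.pi)) ^ 2 * ENNReal.ofReal R := by
  set A := Γ.portion t R with hA
  set B := Γ.carrier ∩ {τ | 3 * R ≤ ‖τ - t‖ ∧ ‖τ - t‖ < 4 * R} with hB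
  have hcont : Continuous fun τ : ℂ => ‖τ - t‖ := by fun_prop
  have hAm : MeasurableSet A := Γ.measurableSet_portion t R
  have hBm : MeasurableSet B := Γ.isCompact_carrier.measurableSet.inter
    ((isClosed_le continuous_const hcont).measurableSet.inter
      (isOpen_lt hcont continuous_const).measurableSet)
  have hBμ : ENNReal.ofReal R ≤ Γ.lengthMeasure B := by
    convert Γ.ofReal_sub_le_lengthMeasure_annulus ht hq (a := 3 * R) (by positivity) htq using 2
    ring
  have hAμ : ENNReal.ofReal R ≤ Γ.lengthMeasure A := by
    have := Γ.ofReal_sub_le_lengthMeasure_annulus ht hq le_rfl (b := R) (by linarith)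
    rw [sub_zero] at this
    exact this.trans (measure_mono fun τ hτ => ⟨hτ.1, hτ.2.2⟩)
  have hR0 : ENNReal.ofReal R ≠ 0 := by simpa using hR
  have hA0 : Γ.lengthMeasure A ≠ 0 := fun h => hR0 (nonpos_iff_eq_zero.1 (h ▸ hAμ))
  have hB0 : Γ.lengthMeasure B ≠ 0 := fun h => hR0 (nonpos_iff_eq_zero.1 (h ▸ hBμ))
  set K : ℝ≥0∞ := C * ENNReal.ofReal (Real.pi / (1 / (8 * R))) with hK
  have hKtop : K ≠ ∞ := ENNReal.mul_ne_top ENNReal.coe_ne_top ENNReal.ofReal_ne_top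
  have hc : 0 < 1 / (8 * R) := by positivity
  -- The phase of `τ - t`, with the value `0` at `τ = t`, which lies outside `B`.
  set e : ℂ → ℂ := fun τ => (τ - t) / ‖τ - t‖ with he
  have hem : Measurable e := by fun_prop
  have he1 : ∀ τ, ‖e τ‖ ≤ 1 := fun τ => by
    simp only [he, norm_div, Complex.norm_real, norm_norm]
    exact div_self_le_one _
  have hsep : ∀ a ∈ A, ∀ b ∈ B, R ≤ ‖b - a‖ := fun a ha b hb => by
    have := norm_sub_le_norm_sub_add_norm_sub b a t
    linarith [ha.2, hb.2.1]
  have hBA := rho_indicator_mul_associateNorm_le hρ hw hS hAm hBm (u := fun _ => 1)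
    (v := fun z => -e z) measurable_const (by simp) (by simpa using he1) hc hR
    (fun τ hτ z hz => by rw [norm_sub_rev]; exact hsep τ hτ z hz)
    (fun τ hτ z hz => by
      have := inv_le_re_phase_div hR hz.2.1 hz.2.2 hτ.2
      rwa [mul_one, neg_div, ← div_neg, neg_sub])
  have hAB := rho_indicator_mul_associateNorm_le hρ hw hS hBm hAm (u := e)
    (v := fun _ => 1) hem he1 (by simp) hc hR (fun τ hτ z hz => hsep z hz τ hτ)
    (fun τ hτ z hz => by
      rw [one_mul]
      exact inv_le_re_phase_div hR hτ.2.1 hτ.2.2 hz.2)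
  rw [← hK] at hBA hAB
  have hw0 : ∀ᵐ x ∂Γ.lengthMeasure, w x ≠ 0 := hw.2.mono fun x hx => hx.1.ne'
  have hwi0 : ∀ᵐ x ∂Γ.lengthMeasure, (w x)⁻¹ ≠ 0 :=
    hw.2.mono fun x hx => ENNReal.inv_ne_zero.2 hx.2.ne
  have ha0 := hρ.indicator_ne_zero hAm hA0 hw.1 hw0
  have hb0 := hρ.indicator_ne_zero hBm hB0 hw.1 hw0
  have ha'0 := hρ.associateNorm_indicator_ne_zero hAm hA0 hw.1.inv hwi0
  have hb'0 := hρ.associateNorm_indicator_ne_zero hBm hB0 hw.1.inv hwi0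
  have hHolder : Γ.lengthMeasure B ≤ ρ (B.indicator w) *
      associateNorm Γ.lengthMeasure ρ (B.indicator fun τ => (w τ)⁻¹) := by
    refine le_trans (le_of_eq ?_) (hρ.lintegral_mul_le (hw.1.indicator hBm)
      ((ENNReal.lt_top_of_mul_ne_top_left (hBA.trans_lt hKtop.lt_top).ne ha'0).ne))
    rw [← lintegral_indicator_one hBm]
    refine lintegral_congr_ae ?_
    filter_upwards [hw.2] with τ hτ
    by_cases hτB : τ ∈ B
    · simp [hτB, ENNReal.mul_inv_cancel hτ.1.ne' hτ.2.ne]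
    · simp [hτB]
  refine ⟨(ENNReal.lt_top_of_mul_ne_top_left (hAB.trans_lt hKtop.lt_top).ne hb'0).ne,
    (ENNReal.lt_top_of_mul_ne_top_right (hBA.trans_lt hKtop.lt_top).ne hb0).ne, ?_⟩
  have hKR : K = C * ENNReal.ofReal (8 * Real.pi) * ENNReal.ofReal R := by
    rw [hK, mul_assoc, ← ENNReal.ofReal_mul (by positivity)]
    congr 2
    field_simp
  refine (ENNReal.mul_le_mul_iff_left hR0 ENNReal.ofReal_ne_top).1 ?_
  calc _ ≤ ρ (A.indicator w) * associateNorm Γ.lengthMeasure ρ (A.indicator fun τ => (w τ)⁻¹) *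
        (ρ (B.indicator w) * associateNorm Γ.lengthMeasure ρ (B.indicator fun τ => (w τ)⁻¹)) := by
        gcongr
        exact hBμ.trans hHolder
    _ = (ρ (A.indicator w) * associateNorm Γ.lengthMeasure ρ (B.indicator fun τ => (w τ)⁻¹)) *
        (ρ (B.indicator w) * associateNorm Γ.lengthMeasure ρ (A.indicator fun τ => (w τ)⁻¹)) := by
        ring
    _ ≤ K * K := mul_le_mul' hAB hBA
    _ = _ := by rw [hKR]; ring

/-- Both norms in the Muckenhoupt condition are finite on all of `Γ` if they are finite on small
portions, since `Γ` is compact. -/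
theorem rho_carrier_ne_top (hρ : IsBanachFunctionNorm Γ.lengthMeasure ρ)
    (hw : IsWeight Γ.lengthMeasure w) {R : ℝ} (hR : 0 < R)
    (h : ∀ t ∈ Γ.carrier, ρ ((Γ.portion t R).indicator w) ≠ ∞ ∧
      associateNorm Γ.lengthMeasure ρ ((Γ.portion t R).indicator fun τ => (w τ)⁻¹) ≠ ∞) :
    ρ (Γ.carrier.indicator w) ≠ ∞ ∧
      associateNorm Γ.lengthMeasure ρ (Γ.carrier.indicator fun τ => (w τ)⁻¹) ≠ ∞ := by
  have hmono : ∀ {S T : Set ℂ}, MeasurableSet S → MeasurableSet T → S ⊆ T →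
      ρ (S.indicator w) ≤ ρ (T.indicator w) := fun hS hT hST =>
    hρ.mono _ _ (hw.1.indicator hT) (hw.1.indicator hS)
      (Eventually.of_forall (indicator_le_indicator_of_subset hST fun _ => zero_le))
  have hunion : ∀ (S T : Set ℂ) (f : ℂ → ℝ≥0∞),
      (S ∪ T).indicator f ≤ S.indicator f + T.indicator f := fun S T f τ => by
    by_cases h1 : τ ∈ S <;> by_cases h2 : τ ∈ T <;> simp [h1, h2]
  have key : ∃ T, MeasurableSet T ∧ Γ.carrier ⊆ T ∧ ρ (T.indicator w) ≠ ∞ ∧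
      associateNorm Γ.lengthMeasure ρ (T.indicator fun τ => (w τ)⁻¹) ≠ ∞ := by
    refine Γ.isCompact_carrier.induction_on (p := fun S => ∃ T, MeasurableSet T ∧ S ⊆ T ∧
      ρ (T.indicator w) ≠ ∞ ∧
      associateNorm Γ.lengthMeasure ρ (T.indicator fun τ => (w τ)⁻¹) ≠ ∞) ?_ ?_ ?_ ?_
    · refine ⟨∅, MeasurableSet.empty, Subset.rfl, ?_, ?_⟩
      · rw [indicator_empty,
          (hρ.eq_zero_iff (fun _ => 0) aemeasurable_const).2 (EventuallyEq.refl _ _)]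
        exact ENNReal.zero_ne_top
      · simp [associateNorm]
    · rintro S S' hS ⟨T, hT, hST, h1, h2⟩
      exact ⟨T, hT, hS.trans hST, h1, h2⟩
    · rintro S S' ⟨T, hT, hST, h1, h2⟩ ⟨T', hT', hST', h1', h2'⟩
      refine ⟨T ∪ T', hT.union hT', union_subset_union hST hST', ?_, ?_⟩
      · refine ((hρ.mono _ _ ((hw.1.indicator hT).add (hw.1.indicator hT'))
          (hw.1.indicator (hT.union hT')) (Eventually.of_forall (hunion T T' w))).trans
          (hρ.add_le _ _ (hw.1.indicator hT) (hw.1.indicator hT'))).trans_lt ?_ |>.ne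
        exact ENNReal.add_lt_top.2 ⟨h1.lt_top, h1'.lt_top⟩
      · refine ((associateNorm_mono (hunion T T' _)).trans
          (associateNorm_add_le (hw.1.inv.indicator hT))).trans_lt ?_ |>.ne
        exact ENNReal.add_lt_top.2 ⟨h2.lt_top, h2'.lt_top⟩
    · intro t ht
      refine ⟨Γ.portion t R, ?_, Γ.portion t R, Γ.measurableSet_portion t R, Subset.rfl, h t ht⟩
      filter_upwards [self_mem_nhdsWithin, mem_nhdsWithin_of_mem_nhds (Metric.ball_mem_nhds t hR)]
        with τ hτ hτ'
      exact ⟨hτ, by simpa [dist_eq_norm] using hτ'⟩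
  obtain ⟨T, hT, hsub, h1, h2⟩ := key
  exact ⟨((hmono Γ.isCompact_carrier.measurableSet hT hsub).trans_lt h1.lt_top).ne,
    ((associateNorm_mono (indicator_le_indicator_of_subset hsub fun _ => zero_le)).trans_lt
      h2.lt_top).ne⟩

end RectifiableJordanCurve

theorem mainTheorem6 (Γ : RectifiableJordanCurve) (ρ : (ℂ → ℝ≥0∞) → ℝ≥0∞)
    (hρ : IsBanachFunctionNorm Γ.lengthMeasure ρ) (w : ℂ → ℝ≥0∞)
    (hw : IsWeight Γ.lengthMeasure w) (hS : Γ.CauchyBoundedOn ρ w) :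
    w ∈ Γ.muckenhouptClass ρ := by
  obtain ⟨C, hC⟩ := hS
  obtain ⟨d, hd, hfar⟩ := Γ.exists_pos_forall_exists_le_norm_sub
  -- For `R ≤ d / 4` the curve has a point at distance at least `4R` from `t`, so it crosses the
  -- annulus of radii `3R` and `4R`.
  choose q hq hqt using hfar
  have hsmall (t : ℂ) (ht : t ∈ Γ.carrier) (R : ℝ) (hR : 0 < R) (hRd : R ≤ d / 4) :=
    RectifiableJordanCurve.rho_portion_mul_associateNorm_portion_le hρ hw hC hR ht (hq t)
      (by linarith [hqt t] : 4 * R ≤ ‖q t - t‖)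
  have hd4 : 0 < d / 4 := by positivity
  obtain ⟨hX, hX'⟩ := RectifiableJordanCurve.rho_carrier_ne_top hρ hw hd4 fun t ht =>
    ⟨(hsmall t ht _ hd4 le_rfl).1, (hsmall t ht _ hd4 le_rfl).2.1⟩
  refine ⟨hw, lt_of_le_of_lt (b := max ((C * ENNReal.ofReal (8 * Real.pi)) ^ 2)
    ((ENNReal.ofReal (d / 4))⁻¹ * ρ (Γ.carrier.indicator w) *
      associateNorm Γ.lengthMeasure ρ (Γ.carrier.indicator fun τ => (w τ)⁻¹))) ?_ ?_⟩
  · refine iSup₂_le fun t ht => iSup₂_le fun R hR => ?_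
    rcases le_or_gt R (d / 4) with hRd | hRd
    · refine le_max_of_le_left ?_
      have hR0 : ENNReal.ofReal R ≠ 0 := by simpa using hR
      rw [RectifiableJordanCurve.muckenhouptQuantity, mul_assoc]
      refine (mul_le_mul_right (hsmall t ht R hR hRd).2.2 _).trans (le_of_eq ?_)
      rw [mul_comm, mul_assoc, ENNReal.mul_inv_cancel hR0 ENNReal.ofReal_ne_top, mul_one]
    · refine le_max_of_le_right ?_
      have hsub : Γ.portion t R ⊆ Γ.carrier := fun τ hτ => hτ.1
      have hle : ∀ f : ℂ → ℝ≥0∞, (Γ.portion t R).indicator f ≤ Γ.carrier.indicator f := fun f =>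
        indicator_le_indicator_of_subset hsub fun _ => zero_le
      refine mul_le_mul' (mul_le_mul' ?_ ?_) (associateNorm_mono (hle _))
      · exact ENNReal.inv_le_inv.2 (ENNReal.ofReal_le_ofReal hRd.le)
      · exact hρ.mono _ _ (hw.1.indicator Γ.isCompact_carrier.measurableSet)
          (hw.1.indicator (Γ.measurableSet_portion t R)) (Eventually.of_forall (hle w))
  · refine max_lt (ENNReal.pow_lt_top (ENNReal.mul_lt_top ENNReal.coe_lt_top
      ENNReal.ofReal_lt_top)) (ENNReal.mul_lt_top (ENNReal.mul_lt_top ?_ hX.lt_top) hX'.lt_top)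
    exact ENNReal.inv_lt_top.2 (ENNReal.ofReal_pos.2 hd4)
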